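/- Let $n\ge 2$, $m\ge 1$, $A\in\mathbb R^{n\times m}$ with columns $c_1,\dots,c_m\in\mathbb R^n$, and let $S_n=\{x\in\mathbb R^n: x_i\ge 0,\ \sum_i x_i=1\}$. Consider the zero-sum game in which, for mixed strategies $x\in S_n$ and $y\in S_m$, Player 1 receives $x^\top A y$ and Player 2 receives $-x^\top A y$. Let $\mathcal X^*\subseteq S_n$ be the set of equilibrium strategies of Player 1, i.e. of those $x^*\in S_n$ for which there is $y^*\in S_m$ with $x^\top A y^*\le (x^*)^\top A y^*\le (x^*)^\top A y$ for all $x\in S_n$, $y\in S_m$. Let $\mu$ be the measure on $S_n$ given by $\mu(S)=\lambda_{n-1}(\{(x_1,\dots,x_{n-1}): x\in S\})$, where $\lambda_{n-1}$ is Lebesgue measure on $\mathbb R^{n-1}$, and let $\partial$ denote the boundary relative to the affine hull of $S_n$. The best-response sets are $$\mathrm{BR}_1(y)=\operatorname*{arg\,max}_{i\in[n]}\,(Ay)_i,\qquad \mathrm{BR}_2(x)=\operatorname*{arg\,min}_{j\in[m]}\,c_j^\top x ,$$ so that $\mathrm{BR}_1(0)=[n]$ and $\mathrm{BR}_2(0)=[m]$.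 Fictitious play with prior weights $k_1,k_2\ge 0$ is any sequence $(\hat x(k),\hat y(k))_{k\ge 0}$ such that $\hat x(0)\in S_n$ if $k_1>0$ and $\hat x(0)=0$ if $k_1=0$, $\hat y(0)\in S_m$ if $k_2>0$ and $\hat y(0)=0$ if $k_2=0$, and, for all $k\ge 0$, $$\hat x(k+1)=\frac{(k+k_1)\hat x(k)+e_{p_k}}{k+k_1+1},\qquad \hat y(k+1)=\frac{(k+k_2)\hat y(k)+e_{q_k}}{k+k_2+1}$$ for some $p_k\in \mathrm{BR}_1(\hat y(k))$ and $q_k\in \mathrm{BR}_2(\hat x(k))$, where ties are broken in an arbitrary way. Assume: - (A1) $\mu(\mathcal X^*)>0$; - (A2) $\partial S_n\cap\mathcal X^*=\emptyset$, i.e. every equilibrium strategy of Player 1 is fully mixed; - (A3) for every $x^*\in\partial\mathcal X^*$ there is $l\in[n]$ such that every $w\in\operatorname{conv}\{c_j : j\in \mathrm{BR}_2(x^*),\ c_j\notin\operatorname{span}\{(1,\dots,1)^\top\}\}$ satisfies $w_l<\max_{i\in[n]} w_i$. Then, if Player 1 starts with no prior ($k_1=0$), under any tie-breaking rule and for any prior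 of Player 2, the sequence $\hat x(k)$ does not converge to any point of $\mathcal X^*$. -/

import Mathlib

open Filter Topology MeasureTheory
open scoped Matrix

namespace ZeroSum

/-- `(x, y)` is a mixed Nash equilibrium of the zero-sum game in which Player 1 (rows) receives
`xᵀ A y` and Player 2 (columns) receives `-xᵀ A y`, i.e. a saddle point of `xᵀ A y`. -/
def IsNash {n m : ℕ} (A : Matrix (Fin n) (Fin m) ℝ) (x : Fin n → ℝ) (y : Fin m → ℝ) : Prop :=
  x ∈ stdSimplex ℝ (Fin n) ∧ y ∈ stdSimplex ℝ (Fin m) ∧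
    (∀ x' ∈ stdSimplex ℝ (Fin n), x' ⬝ᵥ (A *ᵥ y) ≤ x ⬝ᵥ (A *ᵥ y)) ∧
    (∀ y' ∈ stdSimplex ℝ (Fin m), x ⬝ᵥ (A *ᵥ y) ≤ x ⬝ᵥ (A *ᵥ y'))

/-- The set of equilibrium strategies of Player 1. -/
def nashSet₁ {n m : ℕ} (A : Matrix (Fin n) (Fin m) ℝ) : Set (Fin n → ℝ) :=
  {x | ∃ y, IsNash A x y}

/-- Pure best responses of Player 1 to `y` (for `y = 0` these are all actions). -/
def bestResponse₁ {n m : ℕ} (A : Matrix (Fin n) (Fin m) ℝ) (y : Fin m → ℝ) : Set (Fin n) :=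
  {i | ∀ i', (A *ᵥ y) i' ≤ (A *ᵥ y) i}

/-- Pure best responses of Player 2 to `x` (for `x = 0` these are all actions). -/
def bestResponse₂ {n m : ℕ} (A : Matrix (Fin n) (Fin m) ℝ) (x : Fin n → ℝ) : Set (Fin m) :=
  {j | ∀ j', (x ᵥ* A) j ≤ (x ᵥ* A) j'}

/-- The chart `(x₁, …, xₙ) ↦ (x₁, …, xₙ₋₁)`, a homeomorphism from the affine hull of the simplex
onto `ℝⁿ⁻¹`. -/
def dropLast (n : ℕ) (x : Fin n → ℝ) : Fin (n - 1) → ℝ :=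
  fun i => x (Fin.castLE (Nat.sub_le n 1) i)

/-- The `(n-1)`-dimensional measure on the simplex: Lebesgue measure of the image in `ℝⁿ⁻¹`. -/
noncomputable def simplexMeasure (n : ℕ) (U : Set (Fin n → ℝ)) : ENNReal :=
  volume (dropLast n '' U)

/-- The boundary of `U` relative to the affine hull of the simplex (with the subspace topology). -/
def relBoundary (n : ℕ) (U : Set (Fin n → ℝ)) : Set (Fin n → ℝ) :=
  (Subtype.val : affineSpan ℝ (stdSimplex ℝ (Fin n)) → (Fin n → ℝ)) ''
    frontier (Subtype.val ⁻¹' U)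

/-- A1: Player 1's equilibrium set has positive measure. -/
def PositiveMeasure {n m : ℕ} (A : Matrix (Fin n) (Fin m) ℝ) : Prop :=
  0 < simplexMeasure n (nashSet₁ A)

/-- A2: no equilibrium strategy of Player 1 lies on the boundary of the simplex. -/
def FullyMixed {n m : ℕ} (A : Matrix (Fin n) (Fin m) ℝ) : Prop :=
  relBoundary n (stdSimplex ℝ (Fin n)) ∩ nashSet₁ A = ∅

/-- A3: for each boundary point `x` of Player 1's equilibrium set there is a coordinate `l` which
is not maximal in any convex combination of those columns of `A` that are best responses to `x`
and are not multiples of the all-one vector. -/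
def BoundaryCondition {n m : ℕ} (A : Matrix (Fin n) (Fin m) ℝ) : Prop :=
  ∀ x ∈ relBoundary n (nashSet₁ A), ∃ l : Fin n,
    ∀ w ∈ convexHull ℝ {c : Fin n → ℝ | ∃ j ∈ bestResponse₂ A x,
        c = A.col j ∧ A.col j ∉ Submodule.span ℝ {(fun _ => 1 : Fin n → ℝ)}},
      w l < ⨆ i, w i

/-- Admissible initial data: a nonnegative weight `k`, together with a mixed strategy if `k > 0`
and the zero vector if `k = 0` (no prior). -/
def IsPrior {n : ℕ} (k : ℝ) (x₀ : Fin n → ℝ) : Prop :=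
  0 ≤ k ∧ (0 < k → x₀ ∈ stdSimplex ℝ (Fin n)) ∧ (k = 0 → x₀ = 0)

/-- `(x, y)` is a fictitious play trajectory for `A` with prior weights `k₁`, `k₂`. At every step
the actions played are some best responses; the way ties are broken is unrestricted. -/
structure IsFictitiousPlay {n m : ℕ} (A : Matrix (Fin n) (Fin m) ℝ) (k₁ k₂ : ℝ)
    (x : ℕ → Fin n → ℝ) (y : ℕ → Fin m → ℝ) : Prop where
  prior₁ : IsPrior k₁ (x 0)
  prior₂ : IsPrior k₂ (y 0)
  step : ∀ k : ℕ, ∃ p ∈ bestResponse₁ A (y k), ∃ q ∈ bestResponse₂ A (x k),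
    x (k + 1) = ((k : ℝ) + k₁ + 1)⁻¹ • (((k : ℝ) + k₁) • x k + Pi.single p 1) ∧
    y (k + 1) = ((k : ℝ) + k₂ + 1)⁻¹ • (((k : ℝ) + k₂) • y k + Pi.single q 1)

end ZeroSum

namespace ZeroSum

/-! ### Relative boundary and null sets in the simplex. -/

section Simplex

variable {n : ℕ}

/-! Let `v` be the value. A nonnull equilibrium set forces a column constantly equal to `v`
(`exists_col_eq_value`), so a constant best reply to `x` certifies that `x` is an equilibrium
strategy (off equilibrium, Player 2 answers with nonconstant columns). Suppose the frequencies
converge to an equilibrium `xstar`. It is fully mixed, so every action of Player 1 recurs forever.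
Let `D` be the accumulated payoff vector.

If nonconstant columns recur forever, `xstar` is a boundary point, and (A3) with compactness makes
some coordinate `l` of `D` fall ever further behind the maximum, so `l` stops being played
(`exists_forall_ge_not_isMax`).

If only constant columns are played eventually, the differences of `D` freeze; since every action is
still a best reply at some later time, `D` is itself constant. But constant `D` is incompatible with
an equilibrium `x` (`notMem_nashSet₁_of_add_col_const`, by induction from the pure `x 1`, where the
missing prior enters), so a nonconstant column must follow. -/

theorem mem_affineSpan_stdSimplex {x : Fin n → ℝ} (hx : ∑ i, x i = 1) :
    x ∈ affineSpan ℝ (stdSimplex ℝ (Fin n)) := by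
  have h := affineCombination_mem_affineSpan (k := ℝ) (s := Finset.univ) (w := x) hx
    (fun i => (Pi.single i 1 : Fin n → ℝ))
  rw [Finset.affineCombination_eq_linear_combination _ _ _ hx] at h
  have hx' : ∑ i, x i • (Pi.single i 1 : Fin n → ℝ) = x := by
    ext j
    simp [Finset.sum_apply, Pi.single_apply]
  rw [hx'] at h
  refine affineSpan_mono ℝ ?_ h
  rintro _ ⟨i, rfl⟩
  exact single_mem_stdSimplex ℝ i

/-- An interior point could be moved slightly along `d` within the affine hull without leaving `U`.
-/
theorem mem_relBoundary_of_forall_notMem {U : Set (Fin n → ℝ)} {x d : Fin n → ℝ} (hxU : x ∈ U)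
    (hx : ∑ i, x i = 1) (hd : ∑ i, d i = 0) (hU : ∀ t : ℝ, 0 < t → x + t • d ∉ U) :
    x ∈ relBoundary n U := by
  have hmem : ∀ t : ℝ, x + t • d ∈ affineSpan ℝ (stdSimplex ℝ (Fin n)) := fun t =>
    mem_affineSpan_stdSimplex (by simp [Finset.sum_add_distrib, ← Finset.mul_sum, hx, hd])
  refine ⟨⟨x, mem_affineSpan_stdSimplex hx⟩, ⟨subset_closure hxU, fun hint => ?_⟩, rfl⟩
  let γ : ℝ → affineSpan ℝ (stdSimplex ℝ (Fin n)) := fun t => ⟨x + t • d, hmem t⟩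
  have hγ : Continuous γ := by
    apply Continuous.subtype_mk
    fun_prop
  have hγ0 : γ 0 = ⟨x, mem_affineSpan_stdSimplex hx⟩ := by
    apply Subtype.ext
    simp [γ]
  have hev : ∀ᶠ t in 𝓝 (0 : ℝ), γ t ∈ (Subtype.val ⁻¹' U) := by
    apply hγ.continuousAt.eventually
    rw [hγ0]
    exact mem_interior_iff_mem_nhds.1 hint
  obtain ⟨t, ht, htU⟩ := ((hev.filter_mono nhdsWithin_le_nhds).and
    (self_mem_nhdsWithin : Set.Ioi (0 : ℝ) ∈ 𝓝[>] 0)).exists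
  exact hU t htU ht

theorem sum_single_sub_single (a b : Fin n) :
    ∑ i, (Pi.single a 1 - Pi.single b 1 : Fin n → ℝ) i = 0 := by
  simp

theorem mem_relBoundary_stdSimplex (hn : 2 ≤ n) {x : Fin n → ℝ} (hx : x ∈ stdSimplex ℝ (Fin n))
    {i : Fin n} (hi : x i = 0) : x ∈ relBoundary n (stdSimplex ℝ (Fin n)) := by
  have : Nontrivial (Fin n) := Fin.nontrivial_iff_two_le.2 hn
  obtain ⟨b, hb⟩ := exists_ne i
  refine mem_relBoundary_of_forall_notMem hx hx.2 (sum_single_sub_single b i) fun t ht h => ?_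
  have := h.1 i
  simp [hi, hb.symm] at this
  linarith

/-- A subset of the simplex contained in a nontrivial hyperplane section is null. -/
theorem simplexMeasure_eq_zero_of_dotProduct_eq (hn : 2 ≤ n) {U : Set (Fin n → ℝ)}
    {c : Fin n → ℝ} {v : ℝ} (hc : c ∉ Submodule.span ℝ {(fun _ => 1 : Fin n → ℝ)})
    (hU : ∀ x ∈ U, ∑ i, x i = 1 ∧ x ⬝ᵥ c = v) : simplexMeasure n U = 0 := by
  obtain ⟨N, rfl⟩ : ∃ N, n = N + 1 := ⟨n - 1, by omega⟩
  -- Coefficients after eliminating the last coordinate through `∑ x i = 1`; they all vanish only if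
  -- `c` is constant.
  let b : Fin N → ℝ := fun i => c i.castSucc - c (Fin.last N)
  let φ : (Fin N → ℝ) →ₗ[ℝ] ℝ := Fintype.linearCombination ℝ b
  have hφ : ∀ z, φ z = ∑ i, z i * b i := fun z => by simp [φ, Fintype.linearCombination_apply]
  have hb : ∃ i, b i ≠ 0 := by
    by_contra! h
    refine hc (Submodule.mem_span_singleton.2 ⟨c (Fin.last N), ?_⟩)
    ext i
    refine Fin.lastCases (by simp) (fun j => ?_) i
    have := h j
    simp only [b] at this
    simp
    linarith
  have hker : LinearMap.ker φ ≠ ⊤ := by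
    intro h
    obtain ⟨i, hi⟩ := hb
    have : φ (Pi.single i 1) = 0 := by
      rw [← LinearMap.mem_ker, h]; trivial
    rw [hφ] at this
    simp [Pi.single_apply] at this
    exact hi this
  have himg : ∀ x ∈ U, φ (dropLast (N + 1) x) = v - c (Fin.last N) := by
    intro x hx
    obtain ⟨h1, h2⟩ := hU x hx
    rw [dotProduct, Fin.sum_univ_castSucc] at h2
    rw [Fin.sum_univ_castSucc] at h1
    rw [hφ]
    have hd : ∀ i : Fin N, dropLast (N + 1) x i = x i.castSucc := fun i => rfl
    have : ∑ i, dropLast (N + 1) x i * b i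
        = ∑ i : Fin N, x i.castSucc * c i.castSucc
          - (∑ i : Fin N, x i.castSucc) * c (Fin.last N) := by
      rw [Finset.sum_mul, ← Finset.sum_sub_distrib]
      exact Finset.sum_congr rfl fun i _ => by rw [hd]; simp only [b]; ring
    refine this.trans ?_
    linear_combination h2 - c (Fin.last N) * h1
  rcases U.eq_empty_or_nonempty with rfl | ⟨x₀, hx₀⟩
  · simp [simplexMeasure]
  let z₀ : Fin N → ℝ := dropLast (N + 1) x₀
  have hsub : dropLast (N + 1) '' U ⊆ ((AffineSubspace.mk' z₀ (LinearMap.ker φ) : AffineSubspace ℝ (Fin N → ℝ)) :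
      Set (Fin N → ℝ)) := by
    rintro _ ⟨x, hx, rfl⟩
    rw [SetLike.mem_coe, AffineSubspace.mem_mk', LinearMap.mem_ker, vsub_eq_sub, map_sub]
    exact sub_eq_zero.2 ((himg x hx).trans (himg x₀ hx₀).symm)
  refine measure_mono_null hsub (Measure.addHaar_affineSubspace _ _ fun h => hker ?_)
  rw [← AffineSubspace.direction_mk' z₀ (LinearMap.ker φ), h,
    AffineSubspace.direction_top]

end Simplex

/-! ### Equilibria, the value and constant columns. -/

section Game

variable {n m : ℕ} {A : Matrix (Fin n) (Fin m) ℝ}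

theorem dotProduct_mulVec_eq_sum (x : Fin n → ℝ) (y : Fin m → ℝ) :
    x ⬝ᵥ (A *ᵥ y) = ∑ j, (x ᵥ* A) j * y j := by
  rw [Matrix.dotProduct_mulVec, dotProduct]

theorem le_dotProduct_mulVec {x : Fin n → ℝ} {v : ℝ} (hx : ∀ j, v ≤ (x ᵥ* A) j)
    {y : Fin m → ℝ} (hy : y ∈ stdSimplex ℝ (Fin m)) : v ≤ x ⬝ᵥ (A *ᵥ y) := by
  rw [dotProduct_mulVec_eq_sum]
  calc v = ∑ j, v * y j := by rw [← Finset.mul_sum, hy.2, mul_one]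
    _ ≤ _ := Finset.sum_le_sum fun j _ => mul_le_mul_of_nonneg_right (hx j) (hy.1 j)

/-- Saddle points are interchangeable: equilibrium strategies are those guaranteeing the value, and
`y₀` serves as partner for all of them. -/
theorem mem_nashSet₁_iff {x₀ : Fin n → ℝ} {y₀ : Fin m → ℝ} (h₀ : IsNash A x₀ y₀)
    {x : Fin n → ℝ} : x ∈ nashSet₁ A ↔
      x ∈ stdSimplex ℝ (Fin n) ∧ ∀ j, x₀ ⬝ᵥ (A *ᵥ y₀) ≤ (x ᵥ* A) j := by
  constructor
  · rintro ⟨y, hx, hy, h1, h2⟩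
    refine ⟨hx, fun j => (h₀.2.2.2 y hy).trans ((h1 x₀ h₀.1).trans ?_)⟩
    have := h2 _ (single_mem_stdSimplex ℝ j)
    rwa [dotProduct_mulVec_eq_sum x (Pi.single j 1),
      Finset.sum_eq_single j (fun b _ hb => by simp [hb]) (by simp), Pi.single_eq_same,
      mul_one] at this
  · rintro ⟨hx, hv⟩
    exact ⟨y₀, hx, h₀.2.1,
      fun x' hx' => (h₀.2.2.1 x' hx').trans (le_dotProduct_mulVec hv h₀.2.1),
      fun y' hy' => (h₀.2.2.1 x hx).trans (le_dotProduct_mulVec hv hy')⟩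

theorem pos_of_mem_nashSet₁ (hn : 2 ≤ n) (hA2 : FullyMixed A) {x : Fin n → ℝ}
    (hx : x ∈ nashSet₁ A) (i : Fin n) : 0 < x i := by
  obtain ⟨y, hy⟩ := hx
  refine lt_of_le_of_ne (hy.1.1 i) fun h => ?_
  have : x ∈ relBoundary n (stdSimplex ℝ (Fin n)) ∩ nashSet₁ A :=
    ⟨mem_relBoundary_stdSimplex hn hy.1 h.symm, y, hy⟩
  rwa [hA2] at this

theorem exists_forall_eq_of_mem_span {c : Fin n → ℝ}
    (hc : c ∈ Submodule.span ℝ {(fun _ => 1 : Fin n → ℝ)}) : ∃ a : ℝ, ∀ i, c i = a := by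
  obtain ⟨a, rfl⟩ := Submodule.mem_span_singleton.1 hc
  exact ⟨a, fun i => by simp⟩

theorem mem_span_of_forall_eq {c : Fin n → ℝ} {a : ℝ} (h : ∀ i, c i = a) :
    c ∈ Submodule.span ℝ {(fun _ => 1 : Fin n → ℝ)} :=
  Submodule.mem_span_singleton.2 ⟨a, by ext i; simp [h i]⟩

theorem dotProduct_eq_of_forall_eq {x c : Fin n → ℝ} {a : ℝ} (hx : x ∈ stdSimplex ℝ (Fin n))
    (h : ∀ i, c i = a) : x ⬝ᵥ c = a := by
  rw [dotProduct, Finset.sum_congr rfl fun i _ => by rw [h i], ← Finset.sum_mul, hx.2, one_mul]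

theorem vecMul_apply_eq (x : Fin n → ℝ) (j : Fin m) : (x ᵥ* A) j = x ⬝ᵥ A.col j := rfl

/-- If the equilibrium set of Player 1 is not null, some column is constant, equal to the value. -/
theorem exists_col_eq_value (hn : 2 ≤ n) (hA1 : PositiveMeasure A) {x₀ : Fin n → ℝ}
    {y₀ : Fin m → ℝ} (h₀ : IsNash A x₀ y₀) : ∃ j, ∀ i, A.col j i = x₀ ⬝ᵥ (A *ᵥ y₀) := by
  set v := x₀ ⬝ᵥ (A *ᵥ y₀) with hv
  obtain ⟨j, hj⟩ : ∃ j, 0 < y₀ j := by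
    by_contra! h
    have : ∑ j, y₀ j ≤ 0 := Finset.sum_nonpos fun j _ => h j
    linarith [h₀.2.1.2]
  have htight : ∀ x ∈ nashSet₁ A, x ⬝ᵥ A.col j = v := by
    intro x hx
    obtain ⟨hxS, hxv⟩ := (mem_nashSet₁_iff h₀).1 hx
    -- Complementary slackness: the slacks are nonnegative, so they vanish on the support of `y₀`.
    have h1 : ∑ j, ((x ᵥ* A) j - v) * y₀ j ≤ 0 := by
      simp only [sub_mul, Finset.sum_sub_distrib, ← Finset.mul_sum, h₀.2.1.2]
      rw [← dotProduct_mulVec_eq_sum]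
      linarith [h₀.2.2.1 x hxS]
    have h2 : ((x ᵥ* A) j - v) * y₀ j ≤ ∑ j, ((x ᵥ* A) j - v) * y₀ j :=
      Finset.single_le_sum (f := fun j => ((x ᵥ* A) j - v) * y₀ j)
        (fun i _ => mul_nonneg (sub_nonneg.2 (hxv i)) (h₀.2.1.1 i)) (Finset.mem_univ j)
    have h3 : (x ᵥ* A) j - v ≤ 0 := by
      by_contra! h
      linarith [mul_pos h hj]
    exact le_antisymm (sub_nonpos.1 h3) (hxv j)
  have hmem : A.col j ∈ Submodule.span ℝ {(fun _ => 1 : Fin n → ℝ)} := by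
    by_contra hc
    refine hA1.ne' (simplexMeasure_eq_zero_of_dotProduct_eq hn hc fun x hx => ⟨?_, htight x hx⟩)
    exact ((mem_nashSet₁_iff h₀).1 hx).1.2
  obtain ⟨a, ha⟩ := exists_forall_eq_of_mem_span hmem
  have : a = v := (dotProduct_eq_of_forall_eq h₀.1 ha).symm.trans (htight x₀ ⟨y₀, h₀⟩)
  exact ⟨j, this ▸ ha⟩

/-- An equilibrium strategy against which a nonconstant column is a best response lies on the
boundary of the equilibrium set. -/
theorem mem_relBoundary_nashSet₁ {x₀ : Fin n → ℝ} {y₀ : Fin m → ℝ} (h₀ : IsNash A x₀ y₀)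
    {x : Fin n → ℝ} (hx : x ∈ nashSet₁ A) {j : Fin m} (hj : x ⬝ᵥ A.col j ≤ x₀ ⬝ᵥ (A *ᵥ y₀))
    (hc : A.col j ∉ Submodule.span ℝ {(fun _ => 1 : Fin n → ℝ)}) :
    x ∈ relBoundary n (nashSet₁ A) := by
  obtain ⟨a, b, hab⟩ : ∃ a b, A.col j a < A.col j b := by
    by_contra! h
    rcases isEmpty_or_nonempty (Fin n) with hE | ⟨⟨i⟩⟩
    · exact hc (mem_span_of_forall_eq (a := 0) fun i => hE.elim i)
    · exact hc (mem_span_of_forall_eq (a := A.col j i) fun i' => le_antisymm (h _ _) (h _ _))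
  refine mem_relBoundary_of_forall_notMem hx ((mem_nashSet₁_iff h₀).1 hx).1.2
    (sum_single_sub_single a b) fun t ht h => ?_
  have h1 := ((mem_nashSet₁_iff h₀).1 h).2 j
  rw [vecMul_apply_eq, add_dotProduct, smul_dotProduct, sub_dotProduct, single_one_dotProduct,
    single_one_dotProduct, smul_eq_mul] at h1
  nlinarith

/-- The hull of a finite set is compact, so the continuous gap `max w - w l` attains a positive
minimum. -/
theorem exists_pos_forall_add_le {s : Set (Fin n → ℝ)} (hs : s.Finite) {l : Fin n}
    (hl : ∀ w ∈ convexHull ℝ s, w l < ⨆ i, w i) :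
    ∃ δ > 0, ∀ w ∈ convexHull ℝ s, ∃ i, w l + δ ≤ w i := by
  have : Nonempty (Fin n) := ⟨l⟩
  rcases s.eq_empty_or_nonempty with rfl | hne
  · exact ⟨1, one_pos, by simp⟩
  let f : (Fin n → ℝ) → ℝ := fun w => Finset.univ.sup' Finset.univ_nonempty w - w l
  have hf : Continuous f := by
    refine Continuous.sub ?_ (continuous_apply l)
    exact Continuous.finset_sup'_apply _ fun i _ => continuous_apply i
  obtain ⟨w₀, hw₀, hmin⟩ := (hs.isCompact_convexHull ℝ).exists_isMinOn
    (convexHull_nonempty_iff.2 hne) hf.continuousOn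
  refine ⟨f w₀, ?_, fun w hw => ?_⟩
  · have := hl w₀ hw₀
    rw [← Finset.sup'_univ_eq_ciSup] at this
    exact sub_pos.2 this
  · obtain ⟨i, -, hi⟩ := Finset.exists_mem_eq_sup' Finset.univ_nonempty w
    refine ⟨i, ?_⟩
    have h : f w₀ ≤ f w := hmin hw
    have h' : f w = w i - w l := by simp only [f]; rw [hi]
    linarith

end Game

/-! ### Asymptotics of fictitious play. -/

section Play

variable {n : ℕ}

/-- Empirical frequencies converging to a vector that charges `i` come from a sequence of actions
in which `i` occurs infinitely often. -/
theorem exists_ge_action_eq {x : ℕ → Fin n → ℝ} {p : ℕ → Fin n}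
    (hstep : ∀ k : ℕ, ((k : ℝ) + 1) • x (k + 1) = (k : ℝ) • x k + Pi.single (p k) 1)
    {xstar : Fin n → ℝ} (hlim : Tendsto x atTop (𝓝 xstar)) {i : Fin n} (hi : 0 < xstar i)
    (K : ℕ) : ∃ k ≥ K, p k = i := by
  by_contra! h
  have hconst : ∀ k ≥ K, (k : ℝ) * x k i = K * x K i := by
    intro k hk
    induction k, hk using Nat.le_induction with
    | base => rfl
    | succ k hk ih =>
      have := congrFun (hstep k) i
      simp [Pi.single_eq_of_ne (h k hk).symm] at this
      push_cast
      linarith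
  have h1 : Tendsto (fun k => x k i) atTop (𝓝 (xstar i)) :=
    (continuous_apply i).continuousAt.tendsto.comp hlim
  have h2 : Tendsto (fun k : ℕ => (K * x K i) / (k : ℝ)) atTop (𝓝 0) :=
    tendsto_const_div_atTop_nhds_zero_nat _
  have h3 : (fun k : ℕ => (K * x K i) / (k : ℝ)) =ᶠ[atTop] fun k => x k i := by
    filter_upwards [eventually_ge_atTop (max K 1)] with k hk
    have hk0 : (k : ℝ) ≠ 0 := by
      have : 1 ≤ k := le_trans (le_max_right _ _) hk
      positivity
    rw [← hconst k (le_trans (le_max_left _ _) hk)]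
    field_simp
  exact hi.ne' (tendsto_nhds_unique h1 (h2.congr' h3))

/-- If, infinitely often, the increment of `D` lies in a convex set on which coordinate `l` is
uniformly suboptimal, and otherwise is a constant vector, then eventually coordinate `l` of `D` is
not maximal. -/
theorem exists_forall_ge_not_isMax {D : ℕ → Fin n → ℝ} {c : ℕ → Fin n → ℝ}
    (hD : ∀ k, D (k + 1) = D k + c k) {W : Set (Fin n → ℝ)} (hW : Convex ℝ W) {l : Fin n} {δ : ℝ}
    (hδ : 0 < δ) (hl : ∀ w ∈ W, ∃ i, w l + δ ≤ w i) (K : ℕ)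
    (hc : ∀ k ≥ K, c k ∈ W ∨ ∃ a, ∀ i, c k i = a) (hinf : ∀ K', ∃ k ≥ K', c k ∈ W) :
    ∃ K', ∀ k ≥ K', ∃ i, D k l < D k i := by
  -- `w` averages the `N` increments counted in `W`; `s` collects the constant ones.
  let P : ℕ → ℕ → Prop := fun k N => ∃ w ∈ W, ∃ s : ℝ, ∀ i, D k i = D K i + N * w i + s
  have hstepW : ∀ k N, P k N → c k ∈ W → P (k + 1) (N + 1) := by
    rintro k N ⟨w, hw, s, h⟩ hk
    have hN : (0 : ℝ) < (N : ℝ) + 1 := by positivity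
    refine ⟨((N : ℝ) / (N + 1)) • w + ((1 : ℝ) / (N + 1)) • c k,
      hW hw hk (by positivity) (by positivity) (by field_simp), s, fun i => ?_⟩
    simp only [hD, Pi.add_apply, h i, Pi.smul_apply, smul_eq_mul]
    push_cast
    field_simp
    ring
  have hstep : ∀ k ≥ K, ∀ M, (∃ N ≥ M, P k N) → ∃ N ≥ M, P (k + 1) N := by
    rintro k hk M ⟨N, hN, hP⟩
    rcases hc k hk with h | ⟨a, ha⟩
    · exact ⟨N + 1, by omega, hstepW k N hP h⟩
    · obtain ⟨w, hw, s, h⟩ := hP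
      refine ⟨N, hN, w, hw, s + a, fun i => ?_⟩
      rw [hD, Pi.add_apply, h i, ha i]
      ring
  have hmono : ∀ M k₀, K ≤ k₀ → (∃ N ≥ M, P k₀ N) → ∀ k ≥ k₀, ∃ N ≥ M, P k N := by
    intro M k₀ hk₀ h k hk
    induction k, hk using Nat.le_induction with
    | base => exact h
    | succ k hk ih => exact hstep k (hk₀.trans hk) M ih
  have hall : ∀ M, ∃ k₀ ≥ K, ∃ N ≥ M, P k₀ N := by
    intro M
    induction M with
    | zero =>
      obtain ⟨k, -, hk⟩ := hinf 0
      exact ⟨K, le_rfl, 0, le_rfl, c k, hk, 0, by simp⟩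
    | succ M ih =>
      obtain ⟨k₀, hk₀, hN⟩ := ih
      obtain ⟨k, hk, hkW⟩ := hinf k₀
      obtain ⟨N, hN, hP⟩ := hmono M k₀ hk₀ hN k hk
      exact ⟨k + 1, by omega, N + 1, by omega, hstepW k N hP hkW⟩
  obtain ⟨B, hB⟩ : ∃ B : ℝ, ∀ i, D K l - D K i ≤ B := by
    obtain ⟨B, hB⟩ := (Set.finite_range fun i => D K l - D K i).bddAbove
    exact ⟨B, fun i => hB ⟨i, rfl⟩⟩
  obtain ⟨M, hM⟩ := exists_nat_gt (B / δ)
  obtain ⟨k₀, hk₀, hN⟩ := hall M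
  refine ⟨k₀, fun k hk => ?_⟩
  obtain ⟨N, hNM, w, hw, s, h⟩ := hmono M k₀ hk₀ hN k hk
  obtain ⟨i, hi⟩ := hl w hw
  refine ⟨i, ?_⟩
  rw [h, h]
  have h1 : (M : ℝ) * δ ≤ N * δ := by gcongr
  have h2 : B < M * δ := (div_lt_iff₀ hδ).1 hM
  have h3 : (N : ℝ) * δ ≤ N * (w i - w l) := by gcongr; linarith
  linarith [hB i]

theorem eventually_bestResponse₂_subset {m : ℕ} (A : Matrix (Fin n) (Fin m) ℝ)
    {x : ℕ → Fin n → ℝ} {xstar : Fin n → ℝ} (hlim : Tendsto x atTop (𝓝 xstar)) :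
    ∀ᶠ k in atTop, bestResponse₂ A (x k) ⊆ bestResponse₂ A xstar := by
  have hcont : ∀ j, Tendsto (fun k => (x k ᵥ* A) j) atTop (𝓝 ((xstar ᵥ* A) j)) := fun j => by
    have : Continuous fun z : Fin n → ℝ => (z ᵥ* A) j := by
      simp only [vecMul_apply_eq, dotProduct]
      fun_prop
    exact this.continuousAt.tendsto.comp hlim
  have : ∀ j j', ∀ᶠ k in atTop, (xstar ᵥ* A) j' < (xstar ᵥ* A) j →
      (x k ᵥ* A) j' < (x k ᵥ* A) j := by
    intro j j'
    by_cases h : (xstar ᵥ* A) j' < (xstar ᵥ* A) j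
    · filter_upwards [(hcont j').eventually_lt (hcont j) h] with k hk _ using hk
    · exact Eventually.of_forall fun k h' => absurd h' h
  filter_upwards [eventually_all.2 fun j => eventually_all.2 fun j' => this j j'] with k hk j hj j'
  by_contra! h
  exact absurd (hj j') (not_le.2 (hk j j' h))

end Play

/-- If a best reply `p` to the weighted past play `D` and a best reply `q` to `x` make the updated
payoffs constant, the updated `x` is not an equilibrium strategy. -/
theorem notMem_nashSet₁_of_add_col_const {n m : ℕ} (hn : 2 ≤ n) {A : Matrix (Fin n) (Fin m) ℝ}
    (hA2 : FullyMixed A) {x₀ : Fin n → ℝ} {y₀ : Fin m → ℝ} (h₀ : IsNash A x₀ y₀)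
    {x x' D : Fin n → ℝ} {k a : ℝ} (hk : 0 ≤ k) (hx : x ∈ stdSimplex ℝ (Fin n)) {p : Fin n}
    {q : Fin m} (hp : ∀ i, D i ≤ D p) (hq : x ⬝ᵥ A.col q ≤ x₀ ⬝ᵥ (A *ᵥ y₀))
    (hqBR : q ∈ bestResponse₂ A x)
    (hc : A.col q ∉ Submodule.span ℝ {(fun _ => 1 : Fin n → ℝ)})
    (hx' : (k + 1) • x' = k • x + Pi.single p 1) (hD : ∀ i, D i + A.col q i = a) :
    x' ∉ nashSet₁ A := by
  intro hmem
  -- As `D + A.col q` is constant, the maximizer `p` of `D` minimizes the column. Equilibrium of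
  -- `x'` then puts this minimum at `v` or above, while `x` averages the column to at most `v`:
  -- equality holds, and full mixing makes the column constant.
  have hmin : ∀ i, A.col q p ≤ A.col q i := fun i => by linarith [hp i, hD i, hD p]
  have h1 := ((mem_nashSet₁_iff h₀).1 hmem).2 q
  rw [vecMul_apply_eq] at h1
  have h2 : (k + 1) * (x' ⬝ᵥ A.col q) = k * (x ⬝ᵥ A.col q) + A.col q p := by
    have := congrArg (· ⬝ᵥ A.col q) hx'
    simpa [add_dotProduct, smul_dotProduct] using this
  have hpv : x₀ ⬝ᵥ (A *ᵥ y₀) ≤ A.col q p := by nlinarith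
  have hsum : ∑ i, x i * (A.col q i - A.col q p) = x ⬝ᵥ A.col q - A.col q p := by
    simp only [mul_sub, Finset.sum_sub_distrib, ← Finset.sum_mul, hx.2, one_mul, dotProduct]
  have hnn : ∀ i ∈ Finset.univ, 0 ≤ x i * (A.col q i - A.col q p) :=
    fun i _ => mul_nonneg (hx.1 i) (sub_nonneg.2 (hmin i))
  have hge := Finset.sum_nonneg hnn
  have hxN : x ∈ nashSet₁ A := by
    refine (mem_nashSet₁_iff h₀).2 ⟨hx, fun j => le_trans ?_ (hqBR j)⟩
    rw [vecMul_apply_eq]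
    linarith
  have hz := (Finset.sum_eq_zero_iff_of_nonneg hnn).1 (by linarith)
  refine hc (mem_span_of_forall_eq (a := A.col q p) fun i => ?_)
  rcases mul_eq_zero.1 (hz i (Finset.mem_univ i)) with h | h
  · exact absurd h (pos_of_mem_nashSet₁ hn hA2 hxN i).ne'
  · linarith

end ZeroSum

open ZeroSum in
theorem mainTheorem1 {n m : ℕ} (hn : 2 ≤ n) (A : Matrix (Fin n) (Fin m) ℝ)
    (hA1 : ZeroSum.PositiveMeasure A) (hA2 : ZeroSum.FullyMixed A)
    (hA3 : ZeroSum.BoundaryCondition A)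
    (k₁ k₂ : ℝ) (hk₁ : k₁ = 0)
    (x : ℕ → Fin n → ℝ) (y : ℕ → Fin m → ℝ) (hxy : ZeroSum.IsFictitiousPlay A k₁ k₂ x y) :
    ∀ xstar ∈ ZeroSum.nashSet₁ A, ¬ Tendsto x atTop (𝓝 xstar) := by
  intro xstar hxs hlim
  subst hk₁
  obtain ⟨y₀, h₀⟩ := hxs
  have hxs : xstar ∈ nashSet₁ A := ⟨y₀, h₀⟩
  obtain ⟨j₀, hj₀⟩ := exists_col_eq_value hn hA1 h₀
  have hk₂ := hxy.prior₂.1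
  have hmemN := fun z => mem_nashSet₁_iff h₀ (x := z)
  set v := xstar ⬝ᵥ (A *ᵥ y₀)
  choose p hp q hq hxstep hystep using hxy.step
  have hX : ∀ k : ℕ, ((k : ℝ) + 1) • x (k + 1) = (k : ℝ) • x k + Pi.single (p k) 1 := by
    intro k
    rw [hxstep k, smul_smul, add_zero, mul_inv_cancel₀ (by positivity), one_smul]
  -- Unnormalized payoffs: increments are plain columns, and best replies still maximize.
  let D : ℕ → Fin n → ℝ := fun k => ((k : ℝ) + k₂) • (A *ᵥ y k)
  have hD : ∀ k, D (k + 1) = D k + A.col (q k) := by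
    intro k
    have : ((k : ℝ) + k₂ + 1) ≠ 0 := by positivity
    simp only [D]
    rw [hystep k, Matrix.mulVec_smul, smul_smul, Matrix.mulVec_add, Matrix.mulVec_smul,
      Matrix.mulVec_single_one]
    push_cast
    rw [show (k : ℝ) + 1 + k₂ = (k : ℝ) + k₂ + 1 by ring, mul_inv_cancel₀ this, one_smul]
  have hpD : ∀ k i, D k i ≤ D k (p k) := fun k i => by
    simp only [D, Pi.smul_apply, smul_eq_mul]
    exact mul_le_mul_of_nonneg_left (hp k i) (by positivity)
  have hx1 : x 1 = Pi.single (p 0) 1 := by simpa using hX 0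
  have hxS : ∀ k, x (k + 1) ∈ stdSimplex ℝ (Fin n) := by
    intro k
    induction k with
    | zero => rw [zero_add, hx1]; exact single_mem_stdSimplex ℝ _
    | succ k ih =>
      have h := hxstep (k + 1)
      rw [add_zero, smul_add, smul_smul] at h
      rw [h]
      refine convex_stdSimplex ℝ _ ih (single_mem_stdSimplex ℝ _) (by positivity) (by positivity) ?_
      push_cast
      field_simp
  have hqv : ∀ k, x (k + 1) ⬝ᵥ A.col (q (k + 1)) ≤ v := fun k => by
    rw [← dotProduct_eq_of_forall_eq (hxS k) hj₀]
    exact hq (k + 1) j₀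
  have hproper : ∀ k, x (k + 1) ∉ nashSet₁ A →
      A.col (q (k + 1)) ∉ Submodule.span ℝ {(fun _ => 1 : Fin n → ℝ)} := by
    intro k hk hspan
    obtain ⟨a, ha⟩ := exists_forall_eq_of_mem_span hspan
    have hva := ((hmemN xstar).1 hxs).2 (q (k + 1))
    rw [vecMul_apply_eq, dotProduct_eq_of_forall_eq h₀.1 ha] at hva
    refine hk ((hmemN _).2 ⟨hxS k, fun j => le_trans ?_ (hq (k + 1) j)⟩)
    rwa [vecMul_apply_eq, dotProduct_eq_of_forall_eq (hxS k) ha]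
  have hinv : ∀ k a, (∀ i, D (k + 1) i = a) → x (k + 1) ∉ nashSet₁ A := by
    intro k
    induction k with
    | zero =>
      intro a _ hmem
      have : Nontrivial (Fin n) := Fin.nontrivial_iff_two_le.2 hn
      obtain ⟨b, hb⟩ := exists_ne (p 0)
      have := pos_of_mem_nashSet₁ hn hA2 hmem b
      rw [zero_add, hx1, Pi.single_eq_of_ne hb] at this
      exact lt_irrefl _ this
    | succ k ih =>
      intro a ha
      have ha' : ∀ i, D (k + 1) i + A.col (q (k + 1)) i = a := fun i => by
        rw [← ha i, hD (k + 1), Pi.add_apply]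
      have hc : A.col (q (k + 1)) ∉ Submodule.span ℝ {(fun _ => 1 : Fin n → ℝ)} := by
        by_contra hspan
        obtain ⟨b, hb⟩ := exists_forall_eq_of_mem_span hspan
        exact hproper k (ih (a - b) fun i => by linarith [ha' i, hb i]) hspan
      exact notMem_nashSet₁_of_add_col_const hn hA2 h₀ (Nat.cast_nonneg (k + 1)) (hxS k)
        (hpD (k + 1)) (hqv k) (hq (k + 1)) hc (hX (k + 1)) ha'
  have hplay : ∀ i K, ∃ k ≥ K, p k = i := fun i K =>
    exists_ge_action_eq hX hlim (pos_of_mem_nashSet₁ hn hA2 hxs i) K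
  by_cases hinf : ∀ K, ∃ k ≥ K, A.col (q k) ∉ Submodule.span ℝ {(fun _ => 1 : Fin n → ℝ)}
  · obtain ⟨K, hK⟩ := eventually_atTop.1 (eventually_bestResponse₂_subset A hlim)
    obtain ⟨k, hk, hkc⟩ := hinf K
    have hbd : xstar ∈ relBoundary n (nashSet₁ A) := by
      refine mem_relBoundary_nashSet₁ h₀ hxs ?_ hkc
      change _ ≤ v
      rw [← dotProduct_eq_of_forall_eq h₀.1 hj₀]
      exact hK k hk (hq k) j₀
    obtain ⟨l, hl⟩ := hA3 xstar hbd
    obtain ⟨δ, hδ, hδl⟩ := exists_pos_forall_add_le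
      ((Set.finite_range A.col).subset (by rintro _ ⟨j, -, rfl, -⟩; exact ⟨j, rfl⟩)) hl
    have hW : ∀ k ≥ K, A.col (q k) ∉ Submodule.span ℝ {(fun _ => 1 : Fin n → ℝ)} →
        A.col (q k) ∈ convexHull ℝ {c : Fin n → ℝ | ∃ j ∈ bestResponse₂ A xstar,
          c = A.col j ∧ A.col j ∉ Submodule.span ℝ {(fun _ => 1 : Fin n → ℝ)}} :=
      fun k hk hc => subset_convexHull ℝ _ ⟨q k, hK k hk (hq k), rfl, hc⟩
    obtain ⟨K', hK'⟩ := exists_forall_ge_not_isMax hD (convex_convexHull ℝ _) hδ hδl K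
      (fun k hk => by
        by_cases hc : A.col (q k) ∈ Submodule.span ℝ {(fun _ => 1 : Fin n → ℝ)}
        · exact Or.inr (exists_forall_eq_of_mem_span hc)
        · exact Or.inl (hW k hk hc))
      (fun K' => by
        obtain ⟨k, hk, hc⟩ := hinf (max K K')
        exact ⟨k, le_trans (le_max_right _ _) hk, hW k (le_trans (le_max_left _ _) hk) hc⟩)
    obtain ⟨k', hk', rfl⟩ := hplay l K'
    obtain ⟨i, hi⟩ := hK' k' hk'
    exact absurd (hpD k' i) (not_le.2 hi)
  · push Not at hinf
    obtain ⟨K, hK⟩ := hinf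
    have hdiff : ∀ k ≥ K, ∀ i i', D k i - D k i' = D K i - D K i' := by
      intro k hk i i'
      induction k, hk using Nat.le_induction with
      | base => rfl
      | succ k hk ih =>
        obtain ⟨a, ha⟩ := exists_forall_eq_of_mem_span (hK k hk)
        rw [hD, Pi.add_apply, Pi.add_apply, ha, ha]
        linarith
    have hle : ∀ i i', D K i ≤ D K i' := by
      intro i i'
      obtain ⟨k, hk, rfl⟩ := hplay i' K
      linarith [hdiff k hk i (p k), hpD k i]
    -- Time `K + 1` rather than `K`, because `x 0 = 0` lies outside the simplex.
    have hout : x (K + 1) ∉ nashSet₁ A := by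
      refine hinv K (D (K + 1) (p 0)) fun i => ?_
      linarith [hdiff (K + 1) (by omega) i (p 0), hle i (p 0), hle (p 0) i]
    exact hproper K hout (hK (K + 1) (by omega))
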